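/- Let $n,s\ge 1$ and let $M$ be a nonempty smooth manifold of dimension $2n+s$ with a Riemannian metric $g$. Let $f,Q$ be smooth $(1,1)$-tensor fields, $\xi_1,\dots,\xi_s$ smooth vector fields and $\eta^1,\dots,\eta^s$ smooth $1$-forms on $M$ such that $f$ has rank $2n$, $Q$ is non-singular, and $$f^2=-Q+\sum_i\eta^i\otimes\xi_i,\qquad \eta^i(\xi_j)=\delta^i_j,\qquad Q\xi_i=\xi_i,\qquad g(fX,fY)=g(X,QY)-\sum_i\eta^i(X)\,\eta^i(Y).$$ Assume that this is a weak almost $\mathcal S$-structure, i.e. $d\eta^i(X,Y)=g(X,fY)$ for all $i$ and all vector fields $X,Y$, where $d\eta(X,Y)=\frac12\{X(\eta(Y))-Y(\eta(X))-\eta([X,Y])\}$. Put $h_i=\frac12\pounds_{\xi_i}f$, $\widetilde h_i=Q^{-1}h_i$ and $\overline\eta=\sum_i\eta^i$. Let $\kappa,\mu\in\mathbb R$ and assume that $M$ is a weak $f$-$(\kappa,\mu)$-manifold, i.e. for all vector fields $X,Y$ and all $i$ $$R_{X,Y}\,\xi_i=\kappa\{\overline\eta(X)f^2Y-\overline\eta(Y)f^2X\}+\mu\{\overline\eta(Y)h_iX-\overline\eta(X)h_iY\},$$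 where $R_{X,Y}=\nabla_X\nabla_Y-\nabla_Y\nabla_X-\nabla_{[X,Y]}$ is the curvature tensor of the Levi-Civita connection $\nabla$ of $g$. Assume moreover that $\pounds_{\xi_i}Q=0$ for all $i$. Then: (i) $\kappa\le 1$, and if $\kappa<1$, then at every point of $M$ the set of eigenvalues of each $\widetilde h_i$ is exactly $\{0,\sqrt{1-\kappa},-\sqrt{1-\kappa}\}$; (ii) $\widetilde h_1=\dots=\widetilde h_s$. -/

import Mathlib

open Bundle VectorField
open scoped Manifold ContDiff

noncomputable section

namespace WeakF

section Basic

variable {d : ℕ} {M : Type*} [TopologicalSpace M] [ChartedSpace (EuclideanSpace ℝ (Fin d)) M]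
  [IsManifold (𝓡 d) ∞ M]

/-- Smoothness of a vector field. -/
def SmoothField (X : Π x : M, TangentSpace (𝓡 d) x) : Prop :=
  ContMDiff (𝓡 d) (𝓡 d).tangent ∞ (fun x : M ↦ (⟨x, X x⟩ : TangentBundle (𝓡 d) M))

/-- Smoothness of a `(1,1)`-tensor field, i.e. of a section of `Hom(TM, TM)`. -/
def SmoothEndo (S : Π x : M, TangentSpace (𝓡 d) x →L[ℝ] TangentSpace (𝓡 d) x) : Prop :=
  ContMDiff (𝓡 d) ((𝓡 d).prod 𝓘(ℝ, EuclideanSpace ℝ (Fin d) →L[ℝ] EuclideanSpace ℝ (Fin d))) ∞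
    (fun x : M ↦ TotalSpace.mk' (EuclideanSpace ℝ (Fin d) →L[ℝ] EuclideanSpace ℝ (Fin d))
      (E := fun x : M ↦ TangentSpace (𝓡 d) x →L[ℝ] TangentSpace (𝓡 d) x) x (S x))

/-- Smoothness of a `1`-form, i.e. of a section of `Hom(TM, ℝ)`. -/
def SmoothForm (α : Π x : M, TangentSpace (𝓡 d) x →L[ℝ] ℝ) : Prop :=
  ContMDiff (𝓡 d) ((𝓡 d).prod 𝓘(ℝ, EuclideanSpace ℝ (Fin d) →L[ℝ] ℝ)) ∞
    (fun x : M ↦ TotalSpace.mk' (EuclideanSpace ℝ (Fin d) →L[ℝ] ℝ)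
      (E := fun x : M ↦ TangentSpace (𝓡 d) x →L[ℝ] Trivial M ℝ x) x (α x))

/-- `dα(X, Y) = ½ {X(α(Y)) - Y(α(X)) - α([X, Y])}`. -/
def extDer (α : Π x : M, TangentSpace (𝓡 d) x →L[ℝ] ℝ)
    (X Y : Π x : M, TangentSpace (𝓡 d) x) (x : M) : ℝ :=
  (1 / 2) * (mvfderiv (𝓡 d) (fun y ↦ α y (Y y)) x (X x)
    - mvfderiv (𝓡 d) (fun y ↦ α y (X y)) x (Y x) - α x (mlieBracket (𝓡 d) X Y x))

/-- The Lie derivative `(£_ξ S) X = [ξ, S X] - S [ξ, X]`, on vector fields. -/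
def lieEndoAux (ξ : Π x : M, TangentSpace (𝓡 d) x)
    (S : Π x : M, TangentSpace (𝓡 d) x →L[ℝ] TangentSpace (𝓡 d) x)
    (X : Π x : M, TangentSpace (𝓡 d) x) (x : M) : TangentSpace (𝓡 d) x :=
  mlieBracket (𝓡 d) ξ (fun y ↦ S y (X y)) x - S x (mlieBracket (𝓡 d) ξ X x)

theorem lieEndoAux_tensorial (ξ : Π x : M, TangentSpace (𝓡 d) x)
    {S : Π x : M, TangentSpace (𝓡 d) x →L[ℝ] TangentSpace (𝓡 d) x} (hS : SmoothEndo S) (x : M) :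
    TensorialAt (𝓡 d) (EuclideanSpace ℝ (Fin d)) (lieEndoAux ξ S · x) x := by
  have key : ∀ {X : Π x : M, TangentSpace (𝓡 d) x},
      MDifferentiableAt (𝓡 d) (𝓡 d).tangent (fun y : M ↦ (⟨y, X y⟩ : TangentBundle (𝓡 d) M)) x →
      MDifferentiableAt (𝓡 d) (𝓡 d).tangent
        (fun y : M ↦ (⟨y, S y (X y)⟩ : TangentBundle (𝓡 d) M)) x := by
    intro X hX
    exact MDifferentiableAt.clm_bundle_apply (b := fun y : M ↦ y)
      ((hS x).mdifferentiableAt (by simp)) hX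
  constructor
  · intro c X hc hX
    have e : (fun y ↦ S y ((c • X) y)) = c • fun y ↦ S y (X y) := by
      ext1 y; simp
    simp only [lieEndoAux]
    rw [e, mlieBracket_smul_right hc (key hX), mlieBracket_smul_right hc hX]
    simp only [map_add, map_smul]
    module
  · intro X Y hX hY
    have e : (fun y ↦ S y ((X + Y) y)) = (fun y ↦ S y (X y)) + fun y ↦ S y (Y y) := by
      ext1 y; simp
    simp only [lieEndoAux]
    rw [e, mlieBracket_add_right (key hX) (key hY), mlieBracket_add_right hX hY]
    simp only [map_add]
    abel

/-- The Lie derivative `£_ξ S` of a smooth `(1,1)`-tensor field, as a `(1,1)`-tensor field. -/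
def lieEndo (ξ : Π x : M, TangentSpace (𝓡 d) x)
    {S : Π x : M, TangentSpace (𝓡 d) x →L[ℝ] TangentSpace (𝓡 d) x} (hS : SmoothEndo S) (x : M) :
    TangentSpace (𝓡 d) x →L[ℝ] TangentSpace (𝓡 d) x :=
  TensorialAt.mkHom (lieEndoAux ξ S · x) x (lieEndoAux_tensorial ξ hS x)

/-- `(£_ξ S) X = [ξ, S X] - S [ξ, X]` for every smooth vector field `X`. -/
theorem lieEndo_apply (ξ : Π x : M, TangentSpace (𝓡 d) x)
    {S : Π x : M, TangentSpace (𝓡 d) x →L[ℝ] TangentSpace (𝓡 d) x} (hS : SmoothEndo S)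
    {X : Π x : M, TangentSpace (𝓡 d) x} (hX : SmoothField X) (x : M) :
    lieEndo ξ hS x (X x)
      = mlieBracket (𝓡 d) ξ (fun y ↦ S y (X y)) x - S x (mlieBracket (𝓡 d) ξ X x) :=
  TensorialAt.mkHom_apply (lieEndoAux_tensorial ξ hS x) ((hX x).mdifferentiableAt (by simp))

/-- The curvature `R_{X,Y} Z = ∇_X ∇_Y Z - ∇_Y ∇_X Z - ∇_{[X,Y]} Z` of a connection on `TM`
(`nabla Z x (X x)` is `∇_X Z` at `x`). -/
def curvature
    (nabla : CovariantDerivative (𝓡 d) (EuclideanSpace ℝ (Fin d))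
      (TangentSpace (𝓡 d) : M → Type _))
    (X Y Z : Π x : M, TangentSpace (𝓡 d) x) (x : M) : TangentSpace (𝓡 d) x :=
  nabla (fun y ↦ nabla Z y (Y y)) x (X x) - nabla (fun y ↦ nabla Z y (X y)) x (Y x)
    - nabla Z x (mlieBracket (𝓡 d) X Y x)

/-- The Levi-Civita connection of the Riemannian metric: the smooth connection on `TM` that is
torsion-free and compatible with the metric. -/
structure IsLeviCivita [RiemannianBundle (fun x : M ↦ TangentSpace (𝓡 d) x)]
    [IsContMDiffRiemannianBundle (𝓡 d) ∞ (EuclideanSpace ℝ (Fin d))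
      (fun x : M ↦ TangentSpace (𝓡 d) x)]
    (nabla : CovariantDerivative (𝓡 d) (EuclideanSpace ℝ (Fin d))
      (TangentSpace (𝓡 d) : M → Type _)) : Prop where
  smooth : nabla.ContMDiffCovariantDerivative ∞
  torsion_free : nabla.torsion = 0
  metric :
    haveI : IsContMDiffRiemannianBundle (𝓡 d) 1 (EuclideanSpace ℝ (Fin d))
      (TangentSpace (𝓡 d) : M → Type _) :=
        IsContMDiffRiemannianBundle.of_le
          (h := ‹IsContMDiffRiemannianBundle (𝓡 d) ∞ (EuclideanSpace ℝ (Fin d))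
            (fun x : M ↦ TangentSpace (𝓡 d) x)›) (by simp)
    nabla.IsMetricCompatible

end Basic

/-- A framed weak `f`-structure `(f, Q, ξ_i, η^i)` on a manifold of dimension `2n + s`. -/
structure FramedWeakFStructure (n s : ℕ) (M : Type*) [TopologicalSpace M]
    [ChartedSpace (EuclideanSpace ℝ (Fin (2 * n + s))) M] [IsManifold (𝓡 (2 * n + s)) ∞ M] where
  f : Π x : M, TangentSpace (𝓡 (2 * n + s)) x →L[ℝ] TangentSpace (𝓡 (2 * n + s)) x
  Q : Π x : M, TangentSpace (𝓡 (2 * n + s)) x →L[ℝ] TangentSpace (𝓡 (2 * n + s)) x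
  ξ : Fin s → Π x : M, TangentSpace (𝓡 (2 * n + s)) x
  η : Fin s → Π x : M, TangentSpace (𝓡 (2 * n + s)) x →L[ℝ] ℝ
  smooth_f : SmoothEndo f
  smooth_Q : SmoothEndo Q
  smooth_ξ : ∀ i, SmoothField (ξ i)
  smooth_η : ∀ i, SmoothForm (η i)
  rank_f : ∀ x, Module.finrank ℝ (LinearMap.range (f x).toLinearMap) = 2 * n
  nonsingular_Q : ∀ x, (Q x).IsInvertible
  f_sq : ∀ x v, f x (f x v) = -Q x v + ∑ i, η i x v • ξ i x
  η_ξ : ∀ i j x, η i x (ξ j x) = if i = j then 1 else 0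
  Q_ξ : ∀ i x, Q x (ξ i x) = ξ i x

namespace FramedWeakFStructure

variable {n s : ℕ} {M : Type*} [TopologicalSpace M]
  [ChartedSpace (EuclideanSpace ℝ (Fin (2 * n + s))) M] [IsManifold (𝓡 (2 * n + s)) ∞ M]

/-- `η̄ = ∑ i, η^i`. -/
def etaBar (F : FramedWeakFStructure n s M) (x : M) : TangentSpace (𝓡 (2 * n + s)) x →L[ℝ] ℝ :=
  ∑ i, F.η i x

/-- `h_i = ½ £_{ξ_i} f`. -/
def h (F : FramedWeakFStructure n s M) (i : Fin s) (x : M) :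
    TangentSpace (𝓡 (2 * n + s)) x →L[ℝ] TangentSpace (𝓡 (2 * n + s)) x :=
  (1 / 2 : ℝ) • lieEndo (F.ξ i) F.smooth_f x

/-- `h̃_i = Q⁻¹ h_i`. -/
def hTilde (F : FramedWeakFStructure n s M) (i : Fin s) (x : M) :
    TangentSpace (𝓡 (2 * n + s)) x →L[ℝ] TangentSpace (𝓡 (2 * n + s)) x :=
  (F.Q x).inverse ∘L F.h i x

/-- The condition `£_{ξ_i} Q = 0` for all `i`. -/
def LieQVanishes (F : FramedWeakFStructure n s M) : Prop :=
  ∀ i x, lieEndo (F.ξ i) F.smooth_Q x = 0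

variable [RiemannianBundle (fun x : M ↦ TangentSpace (𝓡 (2 * n + s)) x)]

/-- The metric is compatible with the framed weak `f`-structure, i.e. the two together form a
weak metric `f`-structure. -/
def IsCompatible (F : FramedWeakFStructure n s M) : Prop :=
  ∀ (x : M) (v w : TangentSpace (𝓡 (2 * n + s)) x),
    inner ℝ (F.f x v) (F.f x w) = inner ℝ v (F.Q x w) - ∑ i, F.η i x v * F.η i x w

/-- A weak almost `𝒮`-structure: a weak metric `f`-structure with `dη^i = Φ` for all `i`,
where `Φ(X, Y) = g(X, f Y)`. -/
structure IsWeakAlmostS (F : FramedWeakFStructure n s M) : Prop where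
  compatible : F.IsCompatible
  d_eta : ∀ (i : Fin s) (X Y : Π x : M, TangentSpace (𝓡 (2 * n + s)) x),
    SmoothField X → SmoothField Y → ∀ x, extDer (F.η i) X Y x = inner ℝ (X x) (F.f x (Y x))

/-- The `(κ, μ)`-nullity condition, for the connection `nabla`. -/
def Nullity (F : FramedWeakFStructure n s M)
    (nabla : CovariantDerivative (𝓡 (2 * n + s)) (EuclideanSpace ℝ (Fin (2 * n + s)))
      (TangentSpace (𝓡 (2 * n + s)) : M → Type _)) (κ μ : ℝ) : Prop :=
  ∀ (i : Fin s) (X Y : Π x : M, TangentSpace (𝓡 (2 * n + s)) x),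
    SmoothField X → SmoothField Y → ∀ x,
    curvature nabla X Y (F.ξ i) x
      = κ • (F.etaBar x (X x) • F.f x (F.f x (Y x)) - F.etaBar x (Y x) • F.f x (F.f x (X x)))
        + μ • (F.etaBar x (Y x) • F.h i x (X x) - F.etaBar x (X x) • F.h i x (Y x))

/-- A weak `f`-`(κ, μ)`-manifold: a weak almost `𝒮`-manifold whose Levi-Civita connection
satisfies the `(κ, μ)`-nullity condition. -/
structure IsWeakFKappaMu
    [IsContMDiffRiemannianBundle (𝓡 (2 * n + s)) ∞ (EuclideanSpace ℝ (Fin (2 * n + s)))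
      (fun x : M ↦ TangentSpace (𝓡 (2 * n + s)) x)]
    (F : FramedWeakFStructure n s M)
    (nabla : CovariantDerivative (𝓡 (2 * n + s)) (EuclideanSpace ℝ (Fin (2 * n + s)))
      (TangentSpace (𝓡 (2 * n + s)) : M → Type _)) (κ μ : ℝ) : Prop where
  weakAlmostS : F.IsWeakAlmostS
  leviCivita : IsLeviCivita nabla
  nullity : F.Nullity nabla κ μ

end FramedWeakFStructure

end WeakF

end

/-! Since `dη^i = Φ` with `Φ(X, Y) = g(X, fY)`, the skew part of `∇ξ_i` is `-f`; let `S_i = ∇ξ_i +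
f` be the symmetric part (`shape`). Closedness of `dη^i` gives `£_{ξ_i} Φ = 0`, hence `h_i = -S_i
f`, `[ξ_i, ξ_j] = 0` and `S_i ξ_j = 0`. The condition `£_{ξ_i} Q = 0` makes `f²` invariant along
`ξ_i`, so `S_i` anticommutes with `f`, `h_i = f S_i` and `∇_{ξ_i} f = 0`.

With `D = ∇_{ξ_j}`, the nullity condition at `R_{ξ_j, Y} ξ_i` reads `[D, S_i] + (S_i - f)(S_j - f) =
κ f² - μ f S_i`. Its part commuting with `f` is `S_i S_j = (κ - 1) f²`, for all `i, j`
(`shape_shape`).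

Everything follows pointwise. By symmetry `g(S_i v, S_j v) = (1 - κ)|fv|²` for all `i, j`. Taking `i
= j` gives `κ ≤ 1`; expanding `|S_i v - S_j v|²` gives `S_i = S_j`, so the `h̃_i` agree. Finally
`h̃_i` anticommutes with `f` and squares to `1 - κ` on the common kernel of the `η^k`, which fixes
its eigenvalues. -/

namespace WeakF

/-! ### Vector fields, brackets and derivations. -/

section Calculus

variable {d : ℕ} {M : Type*} [TopologicalSpace M] [ChartedSpace (EuclideanSpace ℝ (Fin d)) M]

theorem mvfderiv_const_mul_sub_sub {a b c : M → ℝ} {x : M}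
    (ha : MDifferentiableAt (𝓡 d) 𝓘(ℝ, ℝ) a x) (hb : MDifferentiableAt (𝓡 d) 𝓘(ℝ, ℝ) b x)
    (hc : MDifferentiableAt (𝓡 d) 𝓘(ℝ, ℝ) c x) {r : ℝ} (v : TangentSpace (𝓡 d) x) :
    mvfderiv (𝓡 d) (fun y ↦ r * (a y - b y - c y)) x v
      = r * (mvfderiv (𝓡 d) a x v - mvfderiv (𝓡 d) b x v - mvfderiv (𝓡 d) c x v) := by
  have e : (fun y ↦ r * (a y - b y - c y)) = (fun _ ↦ r) * (a - b - c) := rfl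
  rw [e, mvfderiv_mul mdifferentiableAt_const ((ha.sub hb).sub hc), mvfderiv_sub (ha.sub hb) hc,
    mvfderiv_sub ha hb, mvfderiv_const]
  simp

variable [IsManifold (𝓡 d) ∞ M]

theorem SmoothField.mdifferentiableAt {X : Π x : M, TangentSpace (𝓡 d) x} (hX : SmoothField X)
    (x : M) : MDifferentiableAt (𝓡 d) (𝓡 d).tangent
      (fun y : M ↦ (⟨y, X y⟩ : TangentBundle (𝓡 d) M)) x :=
  (hX x).mdifferentiableAt (by simp)

theorem SmoothField.bracket {X Y : Π x : M, TangentSpace (𝓡 d) x} (hX : SmoothField X)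
    (hY : SmoothField Y) : SmoothField (mlieBracket (𝓡 d) X Y) := by
  have : IsManifold (𝓡 d) (minSmoothness ℝ 2) M :=
    IsManifold.of_le (n := ∞) (by simpa using ENat.LEInfty.out)
  have : IsManifold (𝓡 d) (((⊤ : ℕ∞) : WithTop ℕ∞) + 1) M := by simpa using ‹IsManifold (𝓡 d) ∞ M›
  exact ContDiff.mlieBracket_vectorField (m := ⊤) (n := ⊤) hX hY (by simp)

theorem SmoothField.endo {S : Π x : M, TangentSpace (𝓡 d) x →L[ℝ] TangentSpace (𝓡 d) x}
    (hS : SmoothEndo S) {X : Π x : M, TangentSpace (𝓡 d) x} (hX : SmoothField X) :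
    SmoothField (fun x ↦ S x (X x)) :=
  ContMDiff.clm_bundle_apply (b := fun x : M ↦ x) hS hX

theorem SmoothField.add {X Y : Π x : M, TangentSpace (𝓡 d) x} (hX : SmoothField X)
    (hY : SmoothField Y) : SmoothField (X + Y) :=
  ContMDiff.add_section hX hY

theorem SmoothField.sum {ι : Type*} (t : Finset ι) {Z : ι → Π x : M, TangentSpace (𝓡 d) x}
    (hZ : ∀ i, SmoothField (Z i)) : SmoothField (∑ i ∈ t, Z i) := by
  induction t using Finset.cons_induction with
  | empty => exact contMDiff_zeroSection ℝ _
  | cons a t ha ih => rw [Finset.sum_cons]; exact (hZ a).add ih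

theorem mlieBracket_sum_right {ι : Type*} (t : Finset ι)
    {Z : ι → Π x : M, TangentSpace (𝓡 d) x} (hZ : ∀ i, SmoothField (Z i))
    (X : Π x : M, TangentSpace (𝓡 d) x) (x : M) :
    mlieBracket (𝓡 d) X (∑ i ∈ t, Z i) x = ∑ i ∈ t, mlieBracket (𝓡 d) X (Z i) x := by
  induction t using Finset.cons_induction with
  | empty => simp
  | cons a t ha ih =>
    rw [Finset.sum_cons, Finset.sum_cons, mlieBracket_add_right ((hZ a).mdifferentiableAt x)
      ((SmoothField.sum t hZ).mdifferentiableAt x), ih]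

/-- On a Hausdorff manifold every tangent vector is the value of a global smooth field. -/
theorem exists_smoothField_eq [T2Space M] (x : M) (v : TangentSpace (𝓡 d) x) :
    ∃ X : Π x : M, TangentSpace (𝓡 d) x, SmoothField X ∧ X x = v := by
  obtain ⟨s, hs, hsm⟩ := FiberBundle.exists_contMDiffOn_extend (k := ∞) (𝓡 d)
    (EuclideanSpace ℝ (Fin d)) (V := (TangentSpace (𝓡 d) : M → Type _)) v
  obtain ⟨u, hus, hu, hxu⟩ := mem_nhds_iff.1 hs
  obtain ⟨ψ, hψ, -⟩ := (SmoothBumpFunction.nhds_basis_support (I := 𝓡 d)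
    (hu.mem_nhds hxu)).mem_iff.1 (hu.mem_nhds hxu)
  refine ⟨_, ContMDiffOn.smul_section_of_tsupport
    (V := (TangentSpace (𝓡 d) : M → Type _)) (ψ.contMDiff.contMDiffOn) hu hψ (hsm.mono hus), ?_⟩
  simp

/-- The bracket of two fields acts on functions as a commutator. -/
theorem mvfderiv_mlieBracket {X Y Z : Π x : M, TangentSpace (𝓡 d) x} (hX : SmoothField X)
    (hY : SmoothField Y) (hZ : SmoothField Z) {u : M → ℝ} (hu : ContMDiff (𝓡 d) 𝓘(ℝ, ℝ) ∞ u) {x : M}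
    (hZx : Z x ≠ 0)
    (hXu : MDifferentiableAt (𝓡 d) 𝓘(ℝ, ℝ) (fun y ↦ mvfderiv (𝓡 d) u y (X y)) x)
    (hYu : MDifferentiableAt (𝓡 d) 𝓘(ℝ, ℝ) (fun y ↦ mvfderiv (𝓡 d) u y (Y y)) x) :
    mvfderiv (𝓡 d) u x (mlieBracket (𝓡 d) X Y x)
      = mvfderiv (𝓡 d) (fun y ↦ mvfderiv (𝓡 d) u y (Y y)) x (X x)
        - mvfderiv (𝓡 d) (fun y ↦ mvfderiv (𝓡 d) u y (X y)) x (Y x) := by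
  have : IsManifold (𝓡 d) (minSmoothness ℝ 3) M :=
    IsManifold.of_le (n := ∞) (by simpa using ENat.LEInfty.out)
  have hud : ∀ y, MDifferentiableAt (𝓡 d) 𝓘(ℝ, ℝ) u y := fun y ↦ (hu y).mdifferentiableAt (by simp)
  have huZ : SmoothField (u • Z) := ContMDiff.smul_section hu hZ
  have expand : ∀ {W : Π x : M, TangentSpace (𝓡 d) x}, mlieBracket (𝓡 d) W (u • Z)
      = (fun y ↦ mvfderiv (𝓡 d) u y (W y)) • Z + u • mlieBracket (𝓡 d) W Z := by
    intro W
    ext1 y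
    exact mlieBracket_smul_right (hud y) (hZ.mdifferentiableAt y)
  have second : ∀ {V W : Π x : M, TangentSpace (𝓡 d) x}, SmoothField W →
      MDifferentiableAt (𝓡 d) 𝓘(ℝ, ℝ) (fun y ↦ mvfderiv (𝓡 d) u y (W y)) x →
      mlieBracket (𝓡 d) V (mlieBracket (𝓡 d) W (u • Z)) x
      = mvfderiv (𝓡 d) (fun y ↦ mvfderiv (𝓡 d) u y (W y)) x (V x) • Z x
        + mvfderiv (𝓡 d) u x (W x) • mlieBracket (𝓡 d) V Z x
        + (mvfderiv (𝓡 d) u x (V x) • mlieBracket (𝓡 d) W Z x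
        + u x • mlieBracket (𝓡 d) V (mlieBracket (𝓡 d) W Z) x) := by
    intro V W hW h
    have hWZ := (hW.bracket hZ).mdifferentiableAt x
    rw [expand, mlieBracket_add_right (h.smul_section (hZ.mdifferentiableAt x))
      ((hud x).smul_section hWZ), mlieBracket_smul_right h (hZ.mdifferentiableAt x),
      mlieBracket_smul_right (hud x) hWZ]
  have two : ∀ {W : Π x : M, TangentSpace (𝓡 d) x}, SmoothField W →
      ContMDiffAt (𝓡 d) (𝓡 d).tangent (minSmoothness ℝ 2)
        (fun y : M ↦ (⟨y, W y⟩ : TangentBundle (𝓡 d) M)) x := fun hW ↦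
    (hW x).of_le (by simpa using ENat.LEInfty.out)
  -- Jacobi for `X, Y, uZ`, minus `u` times Jacobi for `X, Y, Z`, leaves only a multiple of `Z x`;
  -- its coefficient is the desired difference, and `Z x ≠ 0`.
  have j1 := leibniz_identity_mlieBracket_apply (two hX) (two hY) (two huZ)
  have j2 := leibniz_identity_mlieBracket_apply (two hX) (two hY) (two hZ)
  rw [second hY hYu, second hX hXu, congrFun expand x] at j1
  simp only [Pi.add_apply, Pi.smul_apply', j2] at j1
  rw [← sub_eq_zero, ← smul_eq_zero_iff_left hZx, ← neg_eq_zero]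
  rw [← sub_eq_zero] at j1
  rw [← j1]
  module

end Calculus

/-! ### Pointwise linear algebra. -/

section LinearAlgebra

/-- The nonzero eigenvalues of `H = Q⁻¹ f S`, when `S` anticommutes with `f`, commutes with `Q`
and squares to `(κ - 1) f²`. -/
theorem hasEigenvalue_iff_of_anticommute {E : Type*} [AddCommGroup E] [Module ℝ E]
    {f Q S H : E →ₗ[ℝ] E} {κ : ℝ} (hκ : κ < 1) {ξ u : E}
    (hQ : ∀ v, Q v = 0 → v = 0) (hfQ : ∀ v, f (Q v) = Q (f v)) (hSQ : ∀ v, S (Q v) = Q (S v))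
    (hSf : ∀ v, S (f v) = -f (S v)) (hSS : ∀ v, S (S v) = (κ - 1) • f (f v))
    (hQH : ∀ v, Q (H v) = f (S v)) (hf3 : ∀ v, f (f (f v)) = -Q (f v))
    (hfH : ∀ v, f (f (H v)) = -Q (H v)) (hξ : ξ ≠ 0) (hSξ : S ξ = 0) (hu : f u ≠ 0) (c : ℝ) :
    Module.End.HasEigenvalue H c ↔ c = 0 ∨ c = √(1 - κ) ∨ c = -√(1 - κ) := by
  have inj : ∀ {v w}, Q v = Q w → v = w := fun {v w} h ↦
    sub_eq_zero.1 (hQ _ (by rw [map_sub, h, sub_self]))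
  have hHf : ∀ v, H (f v) = -f (H v) := fun v ↦ inj <| by
    rw [hQH, map_neg, ← hfQ, hQH, hSf, map_neg]
  have hHQ : ∀ v, H (Q v) = Q (H v) := fun v ↦ inj <| by
    rw [hQH, hQH, hSQ, hfQ]
  -- Here `Q² H² = (fS)² = -f² S² = (1 - κ) f⁴`, and `f⁴ v = Q² v`.
  have hHH : ∀ v, f (f v) = -Q v → H (H v) = (1 - κ) • v := fun v hv ↦ inj <| inj <| by
    rw [← hHQ, hQH, hQH, hSf, hSS, map_smul, map_neg, map_smul, hv]
    simp only [map_neg, map_smul, hfQ, hv]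
    module
  set r := √(1 - κ) with hr
  have hr0 : 0 < r := Real.sqrt_pos.2 (by linarith)
  have hrr : r * r = 1 - κ := Real.mul_self_sqrt (by linarith)
  have hfinj : ∀ v, f (f v) = -Q v → v ≠ 0 → f v ≠ 0 := fun v hv h0 h ↦ h0 <| hQ v <| by
    rw [h, map_zero] at hv; simpa using hv.symm
  have mk : ∀ {a : ℝ} {v : E}, H v = a • v → v ≠ 0 → Module.End.HasEigenvalue H a := fun h h0 ↦
    Module.End.hasEigenvalue_of_hasEigenvector (x := _) ⟨Module.End.mem_eigenspace_iff.2 h, h0⟩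
  have both : Module.End.HasEigenvalue H r ∧ Module.End.HasEigenvalue H (-r) := by
    have flip : ∀ {a : ℝ} {v : E}, H v = a • v → H (f v) = (-a) • f v := fun h ↦ by
      rw [hHf, h, map_smul, neg_smul]
    -- As `H² = r²` at `f u`, the vector `(H + r) f u` is an `r`-eigenvector unless it vanishes, and
    -- then `f u` is a `-r`-eigenvector. Applying `f` produces the opposite sign.
    by_cases hz : H (f u) + r • f u = 0
    · have h1 : H (f u) = (-r) • f u := by rw [neg_smul]; exact eq_neg_of_add_eq_zero_left hz
      exact ⟨by simpa using mk (flip h1) (hfinj _ (hf3 u) hu), mk h1 hu⟩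
    · have h1 : H (H (f u) + r • f u) = r • (H (f u) + r • f u) := by
        rw [map_add, hHH _ (hf3 u), map_smul, smul_add, smul_smul, hrr, add_comm]
      have h2 : f (f (H (f u) + r • f u)) = -Q (H (f u) + r • f u) := by
        simp only [map_add, map_smul, hfH, hf3]
        module
      exact ⟨mk h1 hz, mk (flip h1) (hfinj _ h2 hz)⟩
  constructor
  · intro hc
    obtain ⟨v, hv⟩ := hc.exists_hasEigenvector
    have hv1 := hv.apply_eq_smul
    -- An arbitrary `v` need not satisfy `f² v = -Q v`, but `H v` does, so `H³ = (1 - κ) H`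
    -- everywhere.
    have h3 := hHH (H v) (hfH v)
    simp only [hv1, map_smul, smul_smul] at h3
    have h4 : (c * c * c - (1 - κ) * c) • v = 0 := by
      rw [sub_smul, ← h3]; module
    have h5 := (smul_eq_zero.1 h4).resolve_right hv.2
    have h6 : c * ((c - r) * (c + r)) = 0 := by rw [← hrr] at h5; linear_combination h5
    rcases mul_eq_zero.1 h6 with h | h
    · exact .inl h
    · rcases mul_eq_zero.1 h with h | h
      · exact .inr (.inl (by linarith))
      · exact .inr (.inr (by linarith))
  · rintro (rfl | rfl | rfl)
    · refine mk (v := ξ) ?_ hξ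
      apply inj
      simp [hQH, hSξ]
    · exact both.1
    · exact both.2

variable {E : Type*} [NormedAddCommGroup E] [InnerProductSpace ℝ E] {f S T : E →ₗ[ℝ] E} {κ : ℝ}

theorem inner_apply_of_comp_eq (hf : ∀ v w, inner ℝ v (f w) = -inner ℝ (f v) w)
    (hS : ∀ v w, inner ℝ (S v) w = inner ℝ v (S w))
    (hST : ∀ v, S (T v) = (κ - 1) • f (f v)) (v : E) :
    inner ℝ (S v) (T v) = (1 - κ) * inner ℝ (f v) (f v) := by
  rw [hS, hST, inner_smul_right, hf]
  ring

theorem le_one_of_comp_eq (hf : ∀ v w, inner ℝ v (f w) = -inner ℝ (f v) w)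
    (hS : ∀ v w, inner ℝ (S v) w = inner ℝ v (S w))
    (hSS : ∀ v, S (S v) = (κ - 1) • f (f v)) {u : E} (hu : f u ≠ 0) : κ ≤ 1 := by
  have h := inner_apply_of_comp_eq hf hS hSS u
  have h1 : 0 ≤ inner ℝ (S u) (S u) := real_inner_self_nonneg
  have h2 : 0 < inner ℝ (f u) (f u) := real_inner_self_pos.2 hu
  by_contra hκ
  nlinarith

/-- In the expansion of `|Sv - Tv|²` all inner products equal `(1 - κ)|fv|²`, so they cancel. -/
theorem eq_of_comp_eq (hf : ∀ v w, inner ℝ v (f w) = -inner ℝ (f v) w)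
    (hS : ∀ v w, inner ℝ (S v) w = inner ℝ v (S w))
    (hT : ∀ v w, inner ℝ (T v) w = inner ℝ v (T w))
    (hSS : ∀ v, S (S v) = (κ - 1) • f (f v)) (hST : ∀ v, S (T v) = (κ - 1) • f (f v))
    (hTT : ∀ v, T (T v) = (κ - 1) • f (f v)) : S = T := by
  ext v
  rw [← sub_eq_zero, ← inner_self_eq_zero (𝕜 := ℝ), inner_sub_sub_self,
    real_inner_comm (S v) (T v), inner_apply_of_comp_eq hf hS hSS,
    inner_apply_of_comp_eq hf hS hST, inner_apply_of_comp_eq hf hT hTT]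
  simp

end LinearAlgebra

/-! ### Consequences of metric compatibility and vanishing torsion. -/

section LeviCivita

variable {d : ℕ} {M : Type*} [TopologicalSpace M] [ChartedSpace (EuclideanSpace ℝ (Fin d)) M]
  [IsManifold (𝓡 d) ∞ M]

theorem SmoothField.covariant
    {nabla : CovariantDerivative (𝓡 d) (EuclideanSpace ℝ (Fin d))
      (TangentSpace (𝓡 d) : M → Type _)}
    (hn : nabla.ContMDiffCovariantDerivative ∞) {X Y : Π x : M, TangentSpace (𝓡 d) x}
    (hX : SmoothField X) (hY : SmoothField Y) : SmoothField (fun x ↦ nabla Y x (X x)) := by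
  refine ContMDiff.clm_bundle_apply (b := fun x : M ↦ x) ?_ hX
  exact contMDiffOn_univ.1 (hn.contMDiff.contMDiff (contMDiffOn_univ.2 hY))

variable [RiemannianBundle (fun x : M ↦ TangentSpace (𝓡 d) x)]
  [IsContMDiffRiemannianBundle (𝓡 d) ∞ (EuclideanSpace ℝ (Fin d))
      (fun x : M ↦ TangentSpace (𝓡 d) x)]
  {nabla : CovariantDerivative (𝓡 d) (EuclideanSpace ℝ (Fin d))
      (TangentSpace (𝓡 d) : M → Type _)}

theorem SmoothField.contMDiff_inner {X Y : Π x : M, TangentSpace (𝓡 d) x}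
    (hX : SmoothField X) (hY : SmoothField Y) :
    ContMDiff (𝓡 d) 𝓘(ℝ, ℝ) ∞ (fun x : M ↦ inner ℝ (X x) (Y x)) :=
  ContMDiff.inner_bundle hX hY

theorem IsLeviCivita.bracket (hL : IsLeviCivita nabla) {X Y : Π x : M, TangentSpace (𝓡 d) x}
    (hX : SmoothField X) (hY : SmoothField Y) (x : M) :
    mlieBracket (𝓡 d) X Y x = nabla Y x (X x) - nabla X x (Y x) := by
  have := IsManifold.of_le (I := 𝓡 d) (M := M) (m := 2) (n := ∞) ENat.LEInfty.out
  exact (nabla.torsion_eq_zero_iff.1 hL.torsion_free (hX.mdifferentiableAt x)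
    (hY.mdifferentiableAt x)).symm

theorem IsLeviCivita.mvfderiv_inner (hL : IsLeviCivita nabla)
    {X Y Z : Π x : M, TangentSpace (𝓡 d) x} (hY : SmoothField Y) (hZ : SmoothField Z) (x : M) :
    mvfderiv (𝓡 d) (fun y ↦ inner ℝ (Y y) (Z y)) x (X x)
      = inner ℝ (nabla Y x (X x)) (Z x) + inner ℝ (Y x) (nabla Z x (X x)) := by
  have : IsContMDiffRiemannianBundle (𝓡 d) 1 (EuclideanSpace ℝ (Fin d))
      (TangentSpace (𝓡 d) : M → Type _) :=
        IsContMDiffRiemannianBundle.of_le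
          (h := ‹IsContMDiffRiemannianBundle (𝓡 d) ∞ (EuclideanSpace ℝ (Fin d))
            (fun x : M ↦ TangentSpace (𝓡 d) x)›) (by simp)
  exact hL.metric.mvfderiv_inner_eq X (hY.mdifferentiableAt x) (hZ.mdifferentiableAt x)

/-- Metric compatibility rewrites the derivative as inner products of smooth fields. This supplies
the differentiability hypotheses of `mvfderiv_mlieBracket`. -/
theorem IsLeviCivita.contMDiff_mvfderiv_inner (hL : IsLeviCivita nabla)
    {X Y Z : Π x : M, TangentSpace (𝓡 d) x} (hX : SmoothField X) (hY : SmoothField Y)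
    (hZ : SmoothField Z) :
    ContMDiff (𝓡 d) 𝓘(ℝ, ℝ) ∞
      (fun x ↦ mvfderiv (𝓡 d) (fun y ↦ inner ℝ (Y y) (Z y)) x (X x)) := by
  simp only [hL.mvfderiv_inner hY hZ]
  exact ((hX.covariant hL.smooth hY).contMDiff_inner hZ).add
    (hY.contMDiff_inner (hX.covariant hL.smooth hZ))

end LeviCivita

/-! ### Operators on smooth vector fields. -/

section Operators

variable {d : ℕ} {M : Type*} [TopologicalSpace M] [ChartedSpace (EuclideanSpace ℝ (Fin d)) M]
  [IsManifold (𝓡 d) ∞ M]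

variable (d M) in
/-- The module of smooth vector fields. -/
abbrev VecField := Cₛ^∞⟮𝓡 d; EuclideanSpace ℝ (Fin d), (TangentSpace (𝓡 d) : M → Type _)⟯

/-- A field of endomorphisms that preserves smoothness, as an operator on smooth fields. -/
noncomputable def endoOp (S : Π x : M, TangentSpace (𝓡 d) x →L[ℝ] TangentSpace (𝓡 d) x)
    (hS : ∀ X : Π x : M, TangentSpace (𝓡 d) x, SmoothField X → SmoothField fun x ↦ S x (X x)) :
    Module.End ℝ (VecField d M) where
  toFun X := ⟨fun x ↦ S x (X x), hS X X.contMDiff⟩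
  map_add' X Y := by ext x; exact map_add (S x) _ _
  map_smul' c X := by ext x; exact map_smul (S x) _ _

/-- `∇_X`, as an operator on smooth fields. -/
noncomputable def covOp (nabla : CovariantDerivative (𝓡 d) (EuclideanSpace ℝ (Fin d))
      (TangentSpace (𝓡 d) : M → Type _)) (hn : nabla.ContMDiffCovariantDerivative ∞)
    (X : VecField d M) : Module.End ℝ (VecField d M) where
  toFun Y := ⟨fun x ↦ nabla Y x (X x), SmoothField.covariant hn X.contMDiff Y.contMDiff⟩
  map_add' Y Z := by
    ext x
    exact congr($(nabla.isCovariantDerivativeOnUniv.add (x := x) Y.mdifferentiableAt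
      Z.mdifferentiableAt) (X x))
  map_smul' c Y := by
    ext x
    exact congr($(nabla.isCovariantDerivativeOnUniv.smul_const (x := x) c
      Y.mdifferentiableAt) (X x))

end Operators

/-- The part of the curvature identity that commutes with `f`. -/
theorem mul_comp_eq_of_curvature {R A : Type*} [Ring A] [Field R] [CharZero R] [Algebra R A]
    {f S T D h : A} {κ μ : R}
    (hSf : S * f = -(f * S)) (hTf : T * f = -(f * T)) (hD : D * f = f * D)
    (hh : h = f * S)
    (hC : D * (S - f) - (S - f) * (D - (T - f)) = κ • (f * f) - μ • h) :
    f * (S * T) = (κ - 1) • (f * (f * f)) := by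
  have hSf' : ∀ x, S * (f * x) = -(f * (S * x)) := fun x ↦ by
    rw [← mul_assoc, hSf, neg_mul, mul_assoc]
  have hD' : ∀ x, D * (f * x) = f * (D * x) := fun x ↦ by
    rw [← mul_assoc, hD, mul_assoc]
  -- The map `z ↦ fz + zf` kills what anticommutes with `f`, namely `DS - SD`, `Sf`, `fT` and `h`;
  -- it doubles `f` times what commutes with `f`, namely `ST` and `f²`.
  have key := congrArg (fun z ↦ f * z + z * f) hC
  simp only [hh, mul_sub, sub_mul, mul_smul_comm, smul_mul_assoc, mul_assoc, hSf,
    hTf, hD, hSf', hD', mul_neg, neg_mul, neg_neg] at key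
  linear_combination (norm := module) (1 / 2 : R) • key

namespace FramedWeakFStructure

/-! ### Algebraic identities of the structure tensors. -/

section Pointwise

variable {n s : ℕ} {M : Type*} [TopologicalSpace M]
  [ChartedSpace (EuclideanSpace ℝ (Fin (2 * n + s))) M] [IsManifold (𝓡 (2 * n + s)) ∞ M]
  (F : FramedWeakFStructure n s M)

theorem Q_injective (x : M) {v : TangentSpace (𝓡 (2 * n + s)) x} (h : F.Q x v = 0) : v = 0 :=
  (F.nonsingular_Q x).injective (by rw [h, map_zero])

theorem f_f_ξ (i : Fin s) (x : M) : F.f x (F.f x (F.ξ i x)) = 0 := by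
  simp [F.f_sq, F.Q_ξ, F.η_ξ]

theorem f_f_of_η (x : M) {v : TangentSpace (𝓡 (2 * n + s)) x} (hv : ∀ i, F.η i x v = 0) :
    F.f x (F.f x v) = -F.Q x v := by
  simp [F.f_sq, hv]

/-- A vector is zero once `f` and all the `η^i` vanish on it. -/
theorem eq_zero_of_f_of_η (x : M) {v : TangentSpace (𝓡 (2 * n + s)) x} (hf : F.f x v = 0)
    (hv : ∀ i, F.η i x v = 0) : v = 0 :=
  F.Q_injective x <| by
    have := F.f_sq x v
    simpa [hf, hv] using this

theorem ξ_ne_zero (F : FramedWeakFStructure n s M) (i : Fin s) (x : M) : F.ξ i x ≠ 0 := fun h ↦ by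
  simpa [h] using F.η_ξ i i x

theorem two_smul_h (F : FramedWeakFStructure n s M) (i : Fin s) {X : Π x : M, TangentSpace (𝓡 (2 * n + s)) x} (hX : SmoothField X)
    (x : M) : (2 : ℝ) • F.h i x (X x)
      = mlieBracket (𝓡 (2 * n + s)) (F.ξ i) (fun y ↦ F.f y (X y)) x
        - F.f x (mlieBracket (𝓡 (2 * n + s)) (F.ξ i) X x) := by
  rw [← lieEndo_apply (F.ξ i) F.smooth_f hX, h, smul_apply, smul_smul]
  norm_num

/-- The symmetric part `∇ξ_i + f` of `∇ξ_i`. -/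
noncomputable def shape (F : FramedWeakFStructure n s M)
    (nabla : CovariantDerivative (𝓡 (2 * n + s)) (EuclideanSpace ℝ (Fin (2 * n + s)))
      (TangentSpace (𝓡 (2 * n + s)) : M → Type _)) (i : Fin s) (x : M) :
    TangentSpace (𝓡 (2 * n + s)) x →L[ℝ] TangentSpace (𝓡 (2 * n + s)) x :=
  nabla (F.ξ i) x + F.f x

theorem nabla_ξ_apply {F : FramedWeakFStructure n s M}
    {nabla : CovariantDerivative (𝓡 (2 * n + s)) (EuclideanSpace ℝ (Fin (2 * n + s)))
      (TangentSpace (𝓡 (2 * n + s)) : M → Type _)} (i : Fin s) (x : M) (v : TangentSpace (𝓡 (2 * n + s)) x) :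
    nabla (F.ξ i) x v = F.shape nabla i x v - F.f x v := by
  simp [shape]

theorem Q_hTilde (F : FramedWeakFStructure n s M) (i : Fin s) (x : M) (v : TangentSpace (𝓡 (2 * n + s)) x) :
    F.Q x (F.hTilde i x v) = F.h i x v := by
  simp only [hTilde, ContinuousLinearMap.comp_apply]
  obtain ⟨e, he⟩ := F.nonsingular_Q x
  rw [← he, ContinuousLinearMap.inverse_equiv]
  simp

theorem exists_f_ne_zero (F : FramedWeakFStructure n s M) (hn : 0 < n) (x : M) :
    ∃ u, F.f x u ≠ 0 := by
  by_contra! h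
  have h1 := F.rank_f x
  have h2 : (F.f x).toLinearMap = 0 := LinearMap.ext h
  rw [h2, LinearMap.range_zero, finrank_bot] at h1
  omega

variable [RiemannianBundle (fun x : M ↦ TangentSpace (𝓡 (2 * n + s)) x)]
  [T2Space M] {F}

/-- `dη^i(X, Y)` is antisymmetric in `X, Y`, hence so is `g(X, fY)`. -/
theorem IsWeakAlmostS.f_skew (hF : F.IsWeakAlmostS) (i : Fin s) (x : M)
    (v w : TangentSpace (𝓡 (2 * n + s)) x) :
    inner ℝ v (F.f x w) = -inner ℝ (F.f x v) w := by
  obtain ⟨X, hX, rfl⟩ := exists_smoothField_eq x v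
  obtain ⟨Y, hY, rfl⟩ := exists_smoothField_eq x w
  rw [real_inner_comm (Y x), ← hF.d_eta i X Y hX hY x, ← hF.d_eta i Y X hY hX x, extDer, extDer,
    mlieBracket_swap_apply (V := Y)]
  simp only [map_neg]
  ring

theorem IsWeakAlmostS.f_ξ (hF : F.IsWeakAlmostS) (i : Fin s) (x : M) :
    F.f x (F.ξ i x) = 0 := by
  rw [← inner_self_eq_zero (𝕜 := ℝ), hF.f_skew i, F.f_f_ξ, inner_zero_left, neg_zero]

theorem IsWeakAlmostS.η_eq (hF : F.IsWeakAlmostS) (i : Fin s) (x : M)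
    (v : TangentSpace (𝓡 (2 * n + s)) x) : F.η i x v = inner ℝ (F.ξ i x) v := by
  have h := hF.compatible x v (F.ξ i x)
  simp only [hF.f_ξ, inner_zero_right, F.Q_ξ, F.η_ξ, mul_ite, mul_one, mul_zero,
    Finset.sum_ite_eq', Finset.mem_univ, if_true] at h
  rw [real_inner_comm]
  linarith

theorem IsWeakAlmostS.η_f (hF : F.IsWeakAlmostS) (i : Fin s) (x : M)
    (v : TangentSpace (𝓡 (2 * n + s)) x) : F.η i x (F.f x v) = 0 := by
  rw [hF.η_eq, hF.f_skew i, hF.f_ξ, inner_zero_left, neg_zero]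

theorem IsWeakAlmostS.η_Q (hF : F.IsWeakAlmostS) (i : Fin s) (x : M)
    (v : TangentSpace (𝓡 (2 * n + s)) x) : F.η i x (F.Q x v) = F.η i x v := by
  have h := hF.compatible x (F.ξ i x) v
  simp only [hF.f_ξ, inner_zero_left, F.η_ξ, ite_mul, one_mul, zero_mul,
    Finset.sum_ite_eq', Finset.mem_univ, if_true] at h
  rw [hF.η_eq i x (F.Q x v)]
  linarith

/-- Both sides equal `-f³ v`, because `f ξ_i = 0` and `η^i f = 0`. -/
theorem IsWeakAlmostS.f_Q (hF : F.IsWeakAlmostS) (x : M)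
    (v : TangentSpace (𝓡 (2 * n + s)) x) : F.f x (F.Q x v) = F.Q x (F.f x v) := by
  have h := congrArg (F.f x) (F.f_sq x v)
  rw [F.f_f_of_η x fun i ↦ hF.η_f i x v] at h
  simpa [hF.f_ξ] using h.symm

theorem IsWeakAlmostS.η_eq_fun (hF : F.IsWeakAlmostS) (i : Fin s)
    (Y : Π x : M, TangentSpace (𝓡 (2 * n + s)) x) :
    (fun y ↦ F.η i y (Y y)) = fun y ↦ inner ℝ (F.ξ i y) (Y y) :=
  funext fun y ↦ hF.η_eq i y (Y y)

/-- `£_{ξ_j} η^i = 0`. -/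
theorem mvfderiv_η_ξ (hF : F.IsWeakAlmostS) (i j : Fin s)
    {Y : Π x : M, TangentSpace (𝓡 (2 * n + s)) x} (hY : SmoothField Y) (x : M) :
    mvfderiv (𝓡 (2 * n + s)) (fun y ↦ F.η i y (Y y)) x (F.ξ j x)
      = F.η i x (mlieBracket (𝓡 (2 * n + s)) (F.ξ j) Y x) := by
  have h := hF.d_eta i (F.ξ j) Y (F.smooth_ξ j) hY x
  have hc : mvfderiv (𝓡 (2 * n + s)) (fun y ↦ F.η i y (F.ξ j y)) x = 0 := by
    simp only [F.η_ξ]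
    exact mvfderiv_const _
  -- The right side is `g(ξ_j, fY) = η^j(fY) = 0`.
  rw [← hF.η_eq, hF.η_f, extDer, hc] at h
  simp only [zero_apply] at h
  linarith

end Pointwise

/-! ### The symmetric operators `S_i` and the Lie derivatives along `ξ_i`. -/

section Geometry

variable {n s : ℕ} {M : Type*} [TopologicalSpace M] [T2Space M]
  [ChartedSpace (EuclideanSpace ℝ (Fin (2 * n + s))) M] [IsManifold (𝓡 (2 * n + s)) ∞ M]
  [RiemannianBundle (fun x : M ↦ TangentSpace (𝓡 (2 * n + s)) x)]
  [IsContMDiffRiemannianBundle (𝓡 (2 * n + s)) ∞ (EuclideanSpace ℝ (Fin (2 * n + s)))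
      (fun x : M ↦ TangentSpace (𝓡 (2 * n + s)) x)]
  {F : FramedWeakFStructure n s M}
  {nabla : CovariantDerivative (𝓡 (2 * n + s)) (EuclideanSpace ℝ (Fin (2 * n + s)))
      (TangentSpace (𝓡 (2 * n + s)) : M → Type _)}

/-- Without torsion, `2dη^i(X, Y) = g(∇_X ξ_i, Y) - g(∇_Y ξ_i, X)`; equating this with `2g(X, fY)`
identifies the skew part of `∇ξ_i` as `-f`. -/
theorem shape_symm (hF : F.IsWeakAlmostS) (hL : IsLeviCivita nabla) (i : Fin s) (x : M)
    (v w : TangentSpace (𝓡 (2 * n + s)) x) :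
    inner ℝ (F.shape nabla i x v) w = inner ℝ v (F.shape nabla i x w) := by
  obtain ⟨X, hX, rfl⟩ := exists_smoothField_eq x v
  obtain ⟨Y, hY, rfl⟩ := exists_smoothField_eq x w
  have h := hF.d_eta i X Y hX hY x
  have hf := hF.f_skew i x (X x) (Y x)
  rw [extDer, hF.η_eq_fun, hF.η_eq_fun, hL.mvfderiv_inner (F.smooth_ξ i) hY,
    hL.mvfderiv_inner (F.smooth_ξ i) hX, hF.η_eq, hL.bracket hX hY, inner_sub_right] at h
  simp only [nabla_ξ_apply, inner_sub_left, inner_sub_right, real_inner_comm (X x)] at h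
  linarith

theorem contMDiff_η (hF : F.IsWeakAlmostS) (i : Fin s)
    {Y : Π x : M, TangentSpace (𝓡 (2 * n + s)) x} (hY : SmoothField Y) :
    ContMDiff (𝓡 (2 * n + s)) 𝓘(ℝ, ℝ) ∞ fun y ↦ F.η i y (Y y) := by
  rw [hF.η_eq_fun]
  exact (F.smooth_ξ i).contMDiff_inner hY

theorem mdifferentiableAt_mvfderiv_η (hF : F.IsWeakAlmostS) (hL : IsLeviCivita nabla) (i : Fin s)
    {X Y : Π x : M, TangentSpace (𝓡 (2 * n + s)) x} (hX : SmoothField X) (hY : SmoothField Y)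
    (x : M) : MDifferentiableAt (𝓡 (2 * n + s)) 𝓘(ℝ, ℝ)
      (fun y ↦ mvfderiv (𝓡 (2 * n + s)) (fun z ↦ F.η i z (Y z)) y (X y)) x := by
  rw [hF.η_eq_fun]
  exact (hL.contMDiff_mvfderiv_inner hX (F.smooth_ξ i) hY x).mdifferentiableAt (by simp)

/-- `£_{ξ_i} Φ = 0`, where `Φ(X, Y) = g(X, f Y)`. -/
theorem mvfderiv_inner_f (hF : F.IsWeakAlmostS) (hL : IsLeviCivita nabla) (i : Fin s)
    {X Y : Π x : M, TangentSpace (𝓡 (2 * n + s)) x} (hX : SmoothField X) (hY : SmoothField Y)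
    (x : M) :
    mvfderiv (𝓡 (2 * n + s)) (fun y ↦ inner ℝ (X y) (F.f y (Y y))) x (F.ξ i x)
      = inner ℝ (mlieBracket (𝓡 (2 * n + s)) (F.ξ i) X x) (F.f x (Y x))
        + inner ℝ (X x) (F.f x (mlieBracket (𝓡 (2 * n + s)) (F.ξ i) Y x)) := by
  have : IsManifold (𝓡 (2 * n + s)) (minSmoothness ℝ 3) M :=
    IsManifold.of_le (n := ∞) (by simpa using ENat.LEInfty.out)
  have two : ∀ {W : Π x : M, TangentSpace (𝓡 (2 * n + s)) x}, SmoothField W →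
      ContMDiffAt (𝓡 (2 * n + s)) (𝓡 (2 * n + s)).tangent (minSmoothness ℝ 2)
        (fun y : M ↦ (⟨y, W y⟩ : TangentBundle (𝓡 (2 * n + s)) M)) x := fun hW ↦
    (hW x).of_le (by simpa using ENat.LEInfty.out)
  have hξ := F.smooth_ξ i
  have hξX := hξ.bracket hX
  have hξY := hξ.bracket hY
  have hXY := hX.bracket hY
  -- The product rule for `£_{ξ_i}` on `V(η^i(W))`, given `£_{ξ_i} η^i = 0`. With Jacobi for the
  -- bracket term, it says that `£_{ξ_i}` commutes with `d`. The nonvanishing auxiliary field is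
  -- `ξ_i` itself.
  have comm : ∀ {V W : Π x : M, TangentSpace (𝓡 (2 * n + s)) x}, SmoothField V → SmoothField W →
      mvfderiv (𝓡 (2 * n + s)) (fun y ↦ mvfderiv (𝓡 (2 * n + s)) (fun z ↦ F.η i z (W z)) y (V y))
        x (F.ξ i x) = mvfderiv (𝓡 (2 * n + s)) (fun z ↦ F.η i z (W z)) x
          (mlieBracket (𝓡 (2 * n + s)) (F.ξ i) V x)
        + mvfderiv (𝓡 (2 * n + s))
          (fun z ↦ F.η i z (mlieBracket (𝓡 (2 * n + s)) (F.ξ i) W z)) x (V x) := by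
    intro V W hV hW
    rw [mvfderiv_mlieBracket hξ hV hξ (contMDiff_η hF i hW) (F.ξ_ne_zero i x)
      (mdifferentiableAt_mvfderiv_η hF hL i hξ hW x)
      (mdifferentiableAt_mvfderiv_η hF hL i hV hW x)]
    simp only [mvfderiv_η_ξ hF i i hW]
    ring
  have e : (fun y ↦ inner ℝ (X y) (F.f y (Y y))) = fun y ↦ (1 / 2 : ℝ) *
      (mvfderiv (𝓡 (2 * n + s)) (fun z ↦ F.η i z (Y z)) y (X y)
        - mvfderiv (𝓡 (2 * n + s)) (fun z ↦ F.η i z (X z)) y (Y y)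
        - F.η i y (mlieBracket (𝓡 (2 * n + s)) X Y y)) :=
    funext fun y ↦ (hF.d_eta i X Y hX hY y).symm
  have d1 := mdifferentiableAt_mvfderiv_η hF hL i hX hY x
  have d2 := mdifferentiableAt_mvfderiv_η hF hL i hY hX x
  have d3 := (contMDiff_η hF i hXY x).mdifferentiableAt (by simp)
  rw [← hF.d_eta i _ Y hξX hY x, ← hF.d_eta i X _ hX hξY x, e,
    mvfderiv_const_mul_sub_sub d1 d2 d3, extDer, extDer]
  rw [comm hX hY, comm hY hX, mvfderiv_η_ξ hF i i hXY,
    leibniz_identity_mlieBracket_apply (two hξ) (two hX) (two hY), map_add]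
  ring

/-- From `£_{ξ_i} Φ = 0` one gets `g(X, (£_{ξ_i} f)Y) = -(£_{ξ_i} g)(X, fY)`, and `£_{ξ_i} g` is
twice the form of `S_i`. -/
theorem h_apply (hF : F.IsWeakAlmostS) (hL : IsLeviCivita nabla) (i : Fin s) (x : M)
    (v : TangentSpace (𝓡 (2 * n + s)) x) : F.h i x v = -F.shape nabla i x (F.f x v) := by
  rw [← sub_eq_zero, ← smul_eq_zero_iff_right (two_ne_zero' ℝ)]
  refine ext_inner_left ℝ fun w ↦ ?_
  obtain ⟨X, hX, rfl⟩ := exists_smoothField_eq x w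
  obtain ⟨Y, hY, rfl⟩ := exists_smoothField_eq x v
  have hfY := hY.endo F.smooth_f
  have h := mvfderiv_inner_f hF hL i hX hY x
  rw [hL.mvfderiv_inner hX hfY, hL.bracket (F.smooth_ξ i) hX] at h
  rw [smul_sub, F.two_smul_h i hY, hL.bracket (F.smooth_ξ i) hfY]
  simp only [nabla_ξ_apply, inner_sub_left, inner_sub_right, inner_smul_right, inner_neg_right,
    shape_symm hF hL, inner_zero_right] at h ⊢
  have h' := hF.f_skew i x (X x) (F.f x (Y x))
  linarith

/-- The bracket is killed by `f`, from `£_{ξ_i} Φ = 0` evaluated at `ξ_j`, and by every `η^k`, from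
`£_{ξ_i} η^k = 0`. -/
theorem bracket_ξ_ξ (hF : F.IsWeakAlmostS) (hL : IsLeviCivita nabla) (i j : Fin s) (x : M) :
    mlieBracket (𝓡 (2 * n + s)) (F.ξ i) (F.ξ j) x = 0 := by
  apply F.eq_zero_of_f_of_η x
  · refine ext_inner_left ℝ fun w ↦ ?_
    obtain ⟨X, hX, rfl⟩ := exists_smoothField_eq x w
    have h := mvfderiv_inner_f hF hL i hX (F.smooth_ξ j) x
    simp only [hF.f_ξ, inner_zero_right, mvfderiv_const] at h
    rw [inner_zero_right]
    simpa using h.symm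
  · intro k
    rw [← mvfderiv_η_ξ hF k i (F.smooth_ξ j)]
    simp only [F.η_ξ, mvfderiv_const, zero_apply]

/-- Differentiating `g(ξ_i, ξ_j) = δ_ij` makes `S_i ξ_j` antisymmetric in `i, j`; `[ξ_i, ξ_j] = 0`
makes it symmetric. -/
theorem shape_ξ (hF : F.IsWeakAlmostS) (hL : IsLeviCivita nabla) (i j : Fin s) (x : M) :
    F.shape nabla i x (F.ξ j x) = 0 := by
  have anti : F.shape nabla i x (F.ξ j x) = -F.shape nabla j x (F.ξ i x) := by
    refine ext_inner_left ℝ fun w ↦ ?_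
    obtain ⟨X, hX, rfl⟩ := exists_smoothField_eq x w
    have h := hL.mvfderiv_inner (X := X) (F.smooth_ξ i) (F.smooth_ξ j) x
    simp only [← hF.η_eq, F.η_ξ, mvfderiv_const, nabla_ξ_apply, inner_sub_left, map_sub,
      hF.η_f] at h
    rw [hF.η_eq, ← shape_symm hF hL j, shape_symm hF hL i] at h
    have hf := hF.f_skew j x (X x) (F.ξ j x)
    rw [hF.f_ξ, inner_zero_right] at hf
    rw [zero_apply, real_inner_comm (X x)] at h
    rw [inner_neg_right]
    linarith
  have h := hL.bracket (F.smooth_ξ i) (F.smooth_ξ j) x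
  rw [bracket_ξ_ξ hF hL, nabla_ξ_apply, nabla_ξ_apply, hF.f_ξ, hF.f_ξ, anti] at h
  have h2 : (2 : ℝ) • F.shape nabla j x (F.ξ i x) = 0 := by
    rw [h]; module
  rw [anti, (smul_eq_zero_iff_right (two_ne_zero' ℝ)).1 h2, neg_zero]

end Geometry

/-! ### Invariance of `Q` and the nullity condition. -/

section Nullity

variable {n s : ℕ} {M : Type*} [TopologicalSpace M] [T2Space M]
  [ChartedSpace (EuclideanSpace ℝ (Fin (2 * n + s))) M] [IsManifold (𝓡 (2 * n + s)) ∞ M]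
  [RiemannianBundle (fun x : M ↦ TangentSpace (𝓡 (2 * n + s)) x)]
  [IsContMDiffRiemannianBundle (𝓡 (2 * n + s)) ∞ (EuclideanSpace ℝ (Fin (2 * n + s)))
      (fun x : M ↦ TangentSpace (𝓡 (2 * n + s)) x)]
  {F : FramedWeakFStructure n s M}
  {nabla : CovariantDerivative (𝓡 (2 * n + s)) (EuclideanSpace ℝ (Fin (2 * n + s)))
      (TangentSpace (𝓡 (2 * n + s)) : M → Type _)}

/-- `£_{ξ_j} f² = 0`. -/
theorem bracket_f_f (hF : F.IsWeakAlmostS) (hL : IsLeviCivita nabla) (hQ : F.LieQVanishes)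
    (j : Fin s) {Y : Π x : M, TangentSpace (𝓡 (2 * n + s)) x} (hY : SmoothField Y) (x : M) :
    mlieBracket (𝓡 (2 * n + s)) (F.ξ j) (fun y ↦ F.f y (F.f y (Y y))) x
      = F.f x (F.f x (mlieBracket (𝓡 (2 * n + s)) (F.ξ j) Y x)) := by
  have e : (fun y ↦ F.f y (F.f y (Y y))) = (-1 : ℝ) • (fun y ↦ F.Q y (Y y))
      + ∑ k, (fun y ↦ F.η k y (Y y)) • F.ξ k := by
    ext1 y
    simp [F.f_sq, Finset.sum_apply]
  have hQY := hY.endo F.smooth_Q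
  have hZ : ∀ k, SmoothField ((fun y ↦ F.η k y (Y y)) • F.ξ k) := fun k ↦
    ContMDiff.smul_section (contMDiff_η hF k hY) (F.smooth_ξ k)
  have hLQ := lieEndo_apply (F.ξ j) F.smooth_Q hY x
  rw [hQ j x, zero_apply, eq_comm, sub_eq_zero] at hLQ
  rw [e, mlieBracket_add_right ((ContMDiff.const_smul_section hQY x).mdifferentiableAt (by simp))
    ((SmoothField.sum _ hZ).mdifferentiableAt x), mlieBracket_sum_right _ hZ,
    mlieBracket_const_smul_right (hQY.mdifferentiableAt x), hLQ, F.f_sq, neg_one_smul]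
  congr 1
  refine Finset.sum_congr rfl fun k _ ↦ ?_
  rw [mlieBracket_smul_right ((contMDiff_η hF k hY x).mdifferentiableAt (by simp))
    ((F.smooth_ξ k).mdifferentiableAt x), bracket_ξ_ξ hF hL, mvfderiv_η_ξ hF k j hY, smul_zero,
    add_zero]

/-- This is the Leibniz rule applied to `£_{ξ_j} f² = 0`. -/
theorem h_f (hF : F.IsWeakAlmostS) (hL : IsLeviCivita nabla) (hQ : F.LieQVanishes)
    (j : Fin s) (x : M) (v : TangentSpace (𝓡 (2 * n + s)) x) :
    F.h j x (F.f x v) = -F.f x (F.h j x v) := by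
  obtain ⟨Y, hY, rfl⟩ := exists_smoothField_eq x v
  have hfY := hY.endo F.smooth_f
  have h1 := F.two_smul_h j hfY x
  have h2 := congrArg (F.f x) (F.two_smul_h j hY x)
  rw [bracket_f_f hF hL hQ j hY] at h1
  rw [map_smul, map_sub] at h2
  rw [← add_eq_zero_iff_eq_neg, ← smul_eq_zero_iff_right (two_ne_zero' ℝ), smul_add, h1, h2]
  abel

theorem shape_f (hF : F.IsWeakAlmostS) (hL : IsLeviCivita nabla) (hQ : F.LieQVanishes)
    (i : Fin s) (x : M) (v : TangentSpace (𝓡 (2 * n + s)) x) :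
    F.shape nabla i x (F.f x v) = -F.f x (F.shape nabla i x v) := by
  -- Every vector is some `Q w`, that is `-f² w` plus a combination of the `ξ_k`, which `f` and
  -- `S_i` kill. On `f² w` the claim is `h_f` at `f w`.
  obtain ⟨w, rfl⟩ := (F.nonsingular_Q x).surjective v
  have h := h_f hF hL hQ i x (F.f x w)
  rw [h_apply hF hL, h_apply hF hL, map_neg, neg_neg] at h
  have e : F.Q x w = -F.f x (F.f x w) + ∑ k, F.η k x w • F.ξ k x := by rw [F.f_sq]; abel
  simp only [e, map_add, map_neg, map_sum, map_smul, hF.f_ξ, shape_ξ hF hL, smul_zero,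
    Finset.sum_const_zero, add_zero]
  rw [neg_neg, ← h]

theorem h_eq (hF : F.IsWeakAlmostS) (hL : IsLeviCivita nabla) (hQ : F.LieQVanishes)
    (i : Fin s) (x : M) (v : TangentSpace (𝓡 (2 * n + s)) x) :
    F.h i x v = F.f x (F.shape nabla i x v) := by
  rw [h_apply hF hL, shape_f hF hL hQ, neg_neg]

/-- `∇_{ξ_i} f = 0`. -/
theorem nabla_f (hF : F.IsWeakAlmostS) (hL : IsLeviCivita nabla) (hQ : F.LieQVanishes)
    (i : Fin s) {Y : Π x : M, TangentSpace (𝓡 (2 * n + s)) x} (hY : SmoothField Y) (x : M) :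
    nabla (fun y ↦ F.f y (Y y)) x (F.ξ i x) = F.f x (nabla Y x (F.ξ i x)) := by
  have h := F.two_smul_h i hY x
  -- Expanding the brackets gives `2h_i = ∇_{ξ_i} f + 2f S_i`, while `h_i = f S_i`.
  rw [hL.bracket (F.smooth_ξ i) (hY.endo F.smooth_f), hL.bracket (F.smooth_ξ i) hY,
    h_eq hF hL hQ, nabla_ξ_apply, nabla_ξ_apply, shape_f hF hL hQ, map_sub, map_sub] at h
  rw [← sub_eq_zero] at h ⊢
  rw [← neg_eq_zero, ← h]
  module

theorem η_shape (hF : F.IsWeakAlmostS) (hL : IsLeviCivita nabla) (i k : Fin s) (x : M)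
    (v : TangentSpace (𝓡 (2 * n + s)) x) : F.η k x (F.shape nabla i x v) = 0 := by
  rw [hF.η_eq, ← shape_symm hF hL, shape_ξ hF hL, inner_zero_left]

theorem Q_shape (hF : F.IsWeakAlmostS) (hL : IsLeviCivita nabla) (hQ : F.LieQVanishes)
    (i : Fin s) (x : M) (v : TangentSpace (𝓡 (2 * n + s)) x) :
    F.shape nabla i x (F.Q x v) = F.Q x (F.shape nabla i x v) := by
  have e : F.Q x v = -F.f x (F.f x v) + ∑ k, F.η k x v • F.ξ k x := by rw [F.f_sq]; abel
  rw [e, ← neg_neg (F.Q x (F.shape nabla i x v)),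
    ← F.f_f_of_η x fun k ↦ η_shape hF hL i k x v]
  simp [shape_ξ hF hL, shape_f hF hL hQ]

/-- The curvature identity in the direction of `ξ_j`. -/
theorem curvature_ξ (hF : F.IsWeakAlmostS) (hL : IsLeviCivita nabla) (hQ : F.LieQVanishes)
    {κ μ : ℝ} (hN : F.Nullity nabla κ μ) (i j : Fin s)
    {Y : Π x : M, TangentSpace (𝓡 (2 * n + s)) x} (hY : SmoothField Y) (x : M) :
    nabla (fun y ↦ nabla (F.ξ i) y (Y y)) x (F.ξ j x)
      - nabla (F.ξ i) x (mlieBracket (𝓡 (2 * n + s)) (F.ξ j) Y x)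
      = κ • F.f x (F.f x (Y x)) - μ • F.f x (F.shape nabla i x (Y x)) := by
  have h := hN i (F.ξ j) Y (F.smooth_ξ j) hY x
  have h0 : (fun y ↦ nabla (F.ξ i) y (F.ξ j y)) = 0 := by
    ext1 y
    rw [nabla_ξ_apply, shape_ξ hF hL, hF.f_ξ, sub_zero, Pi.zero_apply]
  have h1 : F.etaBar x (F.ξ j x) = 1 := by
    simp [etaBar, F.η_ξ]
  rw [curvature, h0, nabla.zero, h1, hF.f_ξ, map_zero, h_eq hF hL hQ, h_eq hF hL hQ,
    shape_ξ hF hL, map_zero, Pi.zero_apply, zero_apply] at h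
  rw [sub_zero] at h
  rw [h]
  module

/-- The identity is derived among operators on vector fields, since `∇_{ξ_j}` is not pointwise. The
algebra yields it only after applying `f`; as the `η^k` also kill both sides, `f` can be cancelled.
-/
theorem shape_shape (hF : F.IsWeakAlmostS) (hL : IsLeviCivita nabla) (hQ : F.LieQVanishes)
    {κ μ : ℝ} (hN : F.Nullity nabla κ μ) (i j : Fin s) (x : M)
    (v : TangentSpace (𝓡 (2 * n + s)) x) :
    F.shape nabla i x (F.shape nabla j x v) = (κ - 1) • F.f x (F.f x v) := by
  obtain ⟨X, hX, rfl⟩ := exists_smoothField_eq x v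
  have smooth_shape : ∀ k, ∀ X : Π x : M, TangentSpace (𝓡 (2 * n + s)) x, SmoothField X →
      SmoothField fun x ↦ F.shape nabla k x (X x) := fun k X hX ↦
    (SmoothField.covariant hL.smooth hX (F.smooth_ξ k)).add (hX.endo F.smooth_f)
  let f := endoOp F.f fun X hX ↦ hX.endo F.smooth_f
  let S : Fin s → Module.End ℝ (VecField (2 * n + s) M) := fun k ↦
    endoOp (F.shape nabla k) (smooth_shape k)
  let D := covOp nabla hL.smooth ⟨F.ξ j, F.smooth_ξ j⟩
  have anti : ∀ k, S k * f = -(f * S k) := fun k ↦ by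
    ext Y y
    exact shape_f hF hL hQ k y (Y y)
  have hD : D * f = f * D := by
    ext Y y
    exact nabla_f hF hL hQ j Y.contMDiff y
  have hC : D * (S i - f) - (S i - f) * (D - (S j - f)) = κ • (f * f) - μ • (f * S i) := by
    ext Y y
    have h := curvature_ξ hF hL hQ hN i j Y.contMDiff y
    have e : (fun y ↦ nabla (F.ξ i) y (Y y)) = fun y ↦ F.shape nabla i y (Y y) - F.f y (Y y) :=
      funext fun y ↦ nabla_ξ_apply i y (Y y)
    -- Vanishing torsion turns `[ξ_j, Y]` into `(D - (S_j - f)) Y`.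
    rw [hL.bracket (F.smooth_ξ j) Y.contMDiff, nabla_ξ_apply i, nabla_ξ_apply j, e] at h
    exact h
  have key := congr($(mul_comp_eq_of_curvature (anti i) (anti j) hD rfl hC) ⟨X, hX⟩ x)
  change F.f x (F.shape nabla i x (F.shape nabla j x (X x)))
    = (κ - 1) • F.f x (F.f x (F.f x (X x))) at key
  rw [← sub_eq_zero]
  apply F.eq_zero_of_f_of_η x
  · rw [map_sub, key, map_smul, sub_self]
  · intro k
    rw [map_sub, map_smul, η_shape hF hL, hF.η_f, smul_zero, sub_zero]

theorem IsWeakFKappaMu.le_one {κ μ : ℝ} (hF : F.IsWeakFKappaMu nabla κ μ) (hQ : F.LieQVanishes)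
    (hn : 0 < n) (i : Fin s) (x : M) : κ ≤ 1 := by
  obtain ⟨u, hu⟩ := F.exists_f_ne_zero hn x
  exact le_one_of_comp_eq (f := (F.f x).toLinearMap) (S := (F.shape nabla i x).toLinearMap)
    (hF.weakAlmostS.f_skew i x) (shape_symm hF.weakAlmostS hF.leviCivita i x)
    (shape_shape hF.weakAlmostS hF.leviCivita hQ hF.nullity i i x) hu

theorem IsWeakFKappaMu.hasEigenvalue_hTilde_iff {κ μ : ℝ} (hF : F.IsWeakFKappaMu nabla κ μ)
    (hQ : F.LieQVanishes) (hn : 0 < n) (hκ : κ < 1) (i : Fin s) (x : M) (c : ℝ) :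
    Module.End.HasEigenvalue (F.hTilde i x).toLinearMap c ↔
      c = 0 ∨ c = √(1 - κ) ∨ c = -√(1 - κ) := by
  have hS := hF.weakAlmostS
  have hL := hF.leviCivita
  obtain ⟨u, hu⟩ := F.exists_f_ne_zero hn x
  refine hasEigenvalue_iff_of_anticommute (f := (F.f x).toLinearMap)
    (Q := (F.Q x).toLinearMap) (S := (F.shape nabla i x).toLinearMap) hκ (ξ := F.ξ i x)
    (u := u) (fun v hv ↦ F.Q_injective x hv) (hS.f_Q x) (Q_shape hS hL hQ i x)
    (shape_f hS hL hQ i x) (shape_shape hS hL hQ hF.nullity i i x)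
    (fun v ↦ (F.Q_hTilde i x v).trans (h_eq hS hL hQ i x v))
    (fun v ↦ F.f_f_of_η x fun k ↦ hS.η_f k x v)
    (fun v ↦ F.f_f_of_η x fun k ↦ ?_) (F.ξ_ne_zero i x) (shape_ξ hS hL i i x) hu c
  -- The range of `h̃_i` lies in the kernel of `η^k`, since `η^k = η^k Q` and `Q h̃_i = f S_i`.
  change F.η k x (F.hTilde i x v) = 0
  rw [← hS.η_Q, Q_hTilde, h_eq hS hL hQ, hS.η_f]

theorem IsWeakFKappaMu.hTilde_eq {κ μ : ℝ} (hF : F.IsWeakFKappaMu nabla κ μ)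
    (hQ : F.LieQVanishes) (i j : Fin s) (x : M) : F.hTilde i x = F.hTilde j x := by
  have hS := hF.weakAlmostS
  have hL := hF.leviCivita
  have comp := shape_shape hS hL hQ hF.nullity
  have e : (F.shape nabla i x).toLinearMap = (F.shape nabla j x).toLinearMap :=
    eq_of_comp_eq (f := (F.f x).toLinearMap) (hS.f_skew i x) (shape_symm hS hL i x)
      (shape_symm hS hL j x) (comp i i x) (comp i j x) (comp j j x)
  have e' : F.h i x = F.h j x := by
    ext1 v
    rw [h_eq hS hL hQ, h_eq hS hL hQ]
    exact congrArg (F.f x) (LinearMap.congr_fun e v)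
  rw [hTilde, hTilde, e']

end Nullity

end FramedWeakFStructure

end WeakF

theorem mainTheorem6 {n s : ℕ} (hn : 0 < n) (hs : 0 < s) {M : Type*} [TopologicalSpace M]
    [T2Space M] [Nonempty M]
    [ChartedSpace (EuclideanSpace ℝ (Fin (2 * n + s))) M] [IsManifold (𝓡 (2 * n + s)) ∞ M]
    [RiemannianBundle (fun x : M ↦ TangentSpace (𝓡 (2 * n + s)) x)]
    [IsContMDiffRiemannianBundle (𝓡 (2 * n + s)) ∞ (EuclideanSpace ℝ (Fin (2 * n + s)))
      (fun x : M ↦ TangentSpace (𝓡 (2 * n + s)) x)]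
    (F : WeakF.FramedWeakFStructure n s M)
    (nabla : CovariantDerivative (𝓡 (2 * n + s)) (EuclideanSpace ℝ (Fin (2 * n + s)))
      (TangentSpace (𝓡 (2 * n + s)) : M → Type _))
    (κ μ : ℝ) (hF : F.IsWeakFKappaMu nabla κ μ) (hQ : F.LieQVanishes) :
    κ ≤ 1 ∧
    (κ < 1 → ∀ (i : Fin s) (x : M) (c : ℝ),
      Module.End.HasEigenvalue (F.hTilde i x).toLinearMap c ↔
        c = 0 ∨ c = √(1 - κ) ∨ c = -√(1 - κ)) ∧
    (∀ (i j : Fin s) (x : M), F.hTilde i x = F.hTilde j x) :=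
  ⟨‹Nonempty M›.elim fun x ↦ hF.le_one hQ hn ⟨0, hs⟩ x,
    fun hκ i x c ↦ hF.hasEigenvalue_hTilde_iff hQ hn hκ i x c,
    fun i j x ↦ hF.hTilde_eq hQ i j x⟩
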